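/- Let $G$ be an infinite group of cardinality $\kappa$. A bornology on $G$ is a family $\mathcal B$ of subsets of $G$ that is closed under taking finite unions and subsets and contains every finite subset of $G$; it is left invariant if $gB=\{gb:b\in B\}\in\mathcal B$ for all $g\in G$ and $B\in\mathcal B$. A left invariant bornology $\mathcal B$ on $G$ is called maximal if $G\notin\mathcal B$, but $G\in\mathcal B'$ for every left invariant bornology $\mathcal B'$ on $G$ with $\mathcal B\subsetneq\mathcal B'$. Then the set of all maximal left invariant bornologies on $G$ has cardinality exactly $2^{2^{\kappa}}$. -/

import Mathlib

/-- The family of all bounded subsets of a bornology `B` on `X`. It is an ideal of subsets of `X`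
which contains all finite subsets, and it determines `B`. -/
def boundedSets {X : Type*} (B : Bornology X) : Set (Set X) :=
  {A : Set X | @Bornology.IsBounded X B A}

/-- A bornology on a group `G` is left invariant if every left translate `gA` of a bounded set `A`
is bounded. -/
def IsLeftInvariantBornology {G : Type*} [Group G] (B : Bornology G) : Prop :=
  ∀ g : G, ∀ A ∈ boundedSets B, (fun x : G => g * x) '' A ∈ boundedSets B

/-- A maximal left invariant bornology: it is left invariant, `G` itself is not bounded, and `G` is
bounded in every left invariant bornology with a strictly larger family of bounded sets. -/
def IsMaximalLeftInvariantBornology {G : Type*} [Group G] (B : Bornology G) : Prop :=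
  IsLeftInvariantBornology B ∧ (Set.univ : Set G) ∉ boundedSets B ∧
    ∀ B' : Bornology G, IsLeftInvariantBornology B' → boundedSets B ⊂ boundedSets B' →
      (Set.univ : Set G) ∈ boundedSets B'

open Set Filter Cardinal

/-! ### Left invariant bornologies as filters -/

/-! Complements turn left invariant bornologies into left invariant filters finer than `cofinite`,
and maximal ones into minimal proper such filters. Counting filters gives the upper bound. For the
lower bound it suffices to find `2 ^ 2 ^ κ` proper invariant filters, any two containing disjoint
sets: Zorn's lemma puts a minimal filter below each, and these are distinct. An independent family
of `2 ^ κ` sets gives that many separated filters of tails on the ordinal `κ`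
(`exists_separated_filters`). They are carried to `G` along a sequence so sparse
(`exists_sparse_sequence`) that making them invariant keeps them separated (`disjoint_translates`).
-/

theorem mem_boundedSets {X : Type*} {B : Bornology X} {A : Set X} :
    A ∈ boundedSets B ↔ Aᶜ ∈ B.cobounded :=
  Iff.rfl

theorem boundedSets_subset_iff {X : Type*} {B B' : Bornology X} :
    boundedSets B ⊆ boundedSets B' ↔ B'.cobounded ≤ B.cobounded := by
  constructor
  · intro h A hA
    have : Aᶜ ∈ boundedSets B := by rwa [mem_boundedSets, compl_compl]
    simpa [mem_boundedSets] using h this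
  · intro h A hA
    exact h hA

theorem univ_mem_boundedSets_iff {X : Type*} {B : Bornology X} :
    Set.univ ∈ boundedSets B ↔ B.cobounded = ⊥ := by
  rw [mem_boundedSets, compl_univ, empty_mem_iff_bot]

theorem isLeftInvariantBornology_iff {G : Type*} [Group G] {B : Bornology G} :
    IsLeftInvariantBornology B ↔ ∀ g : G, Tendsto (g * ·) B.cobounded B.cobounded := by
  have key (g : G) (A : Set G) :
      (fun x ↦ g * x) '' A ∈ boundedSets B ↔ (g⁻¹ * ·) ⁻¹' Aᶜ ∈ B.cobounded := by
    rw [mem_boundedSets, image_mul_left, preimage_compl]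
  constructor
  · intro h g A hA
    have := (key g⁻¹ Aᶜ).1 (h g⁻¹ Aᶜ (by rwa [mem_boundedSets, compl_compl]))
    simpa using this
  · intro h g A hA
    exact (key g A).2 (h g⁻¹ hA)

/-- Below every proper left invariant filter refining the cofinite filter lies the cobounded filter of a maximal
left invariant bornology. -/
theorem exists_isMaximalLeftInvariantBornology_le {G : Type*} [Group G] (F : Filter G) [F.NeBot]
    (hF : F ≤ cofinite) (hinv : ∀ g : G, Tendsto (g * ·) F F) :
    ∃ B : Bornology G, IsMaximalLeftInvariantBornology B ∧ B.cobounded ≤ F := by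
  let S : Set (Filter G)ᵒᵈ :=
    {H | (OrderDual.ofDual H).NeBot ∧ OrderDual.ofDual H ≤ cofinite ∧
      ∀ g : G, Tendsto (g * ·) (OrderDual.ofDual H) (OrderDual.ofDual H)}
  obtain ⟨M, hFM, hM⟩ := zorn_le_nonempty₀ S (fun c hcS hc y hy ↦ by
    let c' : Set (Filter G) := OrderDual.toDual ⁻¹' c
    have hy' : OrderDual.ofDual y ∈ c' := hy
    refine ⟨OrderDual.toDual (sInf c'), ⟨?_, ?_, ?_⟩, fun z hz ↦ ?_⟩
    · refine sInf_neBot_of_directed' ⟨_, hy'⟩ ?_ fun h ↦ (hcS h).1.ne rfl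
      intro a ha b hb
      rcases hc.total (x := OrderDual.toDual a) (y := OrderDual.toDual b) ha hb with h | h
      · exact ⟨b, hb, h, le_rfl⟩
      · exact ⟨a, ha, le_rfl, h⟩
    · exact (sInf_le hy').trans (hcS hy).2.1
    · intro g
      exact le_sInf fun H hH ↦ ((hcS hH).2.2 g).mono_left (sInf_le hH)
    · exact sInf_le (a := OrderDual.ofDual z) hz) (OrderDual.toDual F) ⟨‹_›, hF, hinv⟩
  obtain ⟨hbot, hcof, hMinv⟩ := hM.prop
  refine ⟨⟨OrderDual.ofDual M, hcof⟩,
    ⟨isLeftInvariantBornology_iff.2 hMinv, fun h ↦ hbot.ne (univ_mem_boundedSets_iff.1 h), ?_⟩, hFM⟩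
  intro B' hB' hlt
  rw [univ_mem_boundedSets_iff]
  by_contra hne
  refine hlt.2 (boundedSets_subset_iff.2 ?_)
  exact hM.2 (y := OrderDual.toDual B'.cobounded)
    ⟨⟨hne⟩, B'.le_cofinite, isLeftInvariantBornology_iff.1 hB'⟩ (boundedSets_subset_iff.1 hlt.1)

theorem mk_bornology_le (X : Type*) : #(Bornology X) ≤ 2 ^ (2 ^ #X : Cardinal) := by
  rw [← mk_set, ← mk_set]
  refine mk_le_of_injective (f := fun B : Bornology X ↦ B.cobounded.sets) fun B C h ↦ ?_
  exact Bornology.ext _ _ (Filter.filter_eq h)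

/-! ### An independent family of sets -/

/-- For `A : Set X`, the pairs `(F, 𝒮)` such that the trace of `A` on `F` belongs to `𝒮`. These sets
form an independent family indexed by `Set X`. -/
def traceSet {X : Type*} (A : Set X) : Set (Finset X × Finset (Finset X)) :=
  {p | ∃ s ∈ p.2, ∀ x, x ∈ s ↔ x ∈ p.1 ∧ x ∈ A}

theorem exists_finset_separating {X : Type*} (𝓐 : Finset (Set X)) :
    ∃ F : Finset X, ∀ A ∈ 𝓐, ∀ B ∈ 𝓐, (∀ x ∈ F, x ∈ A ↔ x ∈ B) → A = B := by
  classical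
  have h (p : Set X × Set X) : ∃ F : Finset X, (∀ x ∈ F, x ∈ p.1 ↔ x ∈ p.2) → p.1 = p.2 := by
    by_cases hp : p.1 = p.2
    · exact ⟨∅, fun _ ↦ hp⟩
    · obtain ⟨x, hx⟩ : ∃ x, ¬ (x ∈ p.1 ↔ x ∈ p.2) := by
        by_contra! h
        exact hp (Set.ext h)
      exact ⟨{x}, fun h ↦ absurd (h x (by simp)) hx⟩
  choose d hd using h
  refine ⟨(𝓐 ×ˢ 𝓐).biUnion d, fun A hA B hB hAB ↦ hd (A, B) fun x hx ↦ hAB x ?_⟩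
  exact Finset.mem_biUnion.2 ⟨(A, B), by simp [hA, hB], hx⟩

theorem exists_mem_traceSet_iff {X : Type*} (𝓐 : Finset (Set X)) (𝒟 : Set (Set X)) :
    ∃ p, ∀ A ∈ 𝓐, p ∈ traceSet A ↔ A ∈ 𝒟 := by
  classical
  obtain ⟨F, hF⟩ := exists_finset_separating 𝓐
  -- Members of `𝓐` have distinct traces on `F`, so listing the traces of those in `𝒟` singles them
  -- out.
  refine ⟨(F, (𝓐.filter (· ∈ 𝒟)).image fun A ↦ F.filter (· ∈ A)), fun A hA ↦ ⟨?_, fun h ↦ ?_⟩⟩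
  · rintro ⟨s, hs, hsA⟩
    simp only [Finset.mem_image, Finset.mem_filter] at hs
    obtain ⟨B, ⟨hB, hBD⟩, rfl⟩ := hs
    rwa [hF A hA B hB fun x hx ↦ ?_]
    simpa [hx] using (hsA x).symm
  · exact ⟨F.filter (· ∈ A), Finset.mem_image_of_mem _ (by simp [hA, h]), by simp⟩

theorem exists_filter_traceSet {X : Type*} (𝒟 : Set (Set X)) :
    ∃ ψ : Filter (Finset X × Finset (Finset X)), ψ.NeBot ∧
      (∀ A ∈ 𝒟, traceSet A ∈ ψ) ∧ ∀ A ∉ 𝒟, (traceSet A)ᶜ ∈ ψ := by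
  let s (A : Set X) : Set (Finset X × Finset (Finset X)) := {p | p ∈ traceSet A ↔ A ∈ 𝒟}
  have hs (A : Set X) : s A ∈ ⨅ A, 𝓟 (s A) := mem_iInf_of_mem A (mem_principal_self _)
  refine ⟨⨅ A, 𝓟 (s A), ?_, fun A hA ↦ ?_, fun A hA ↦ ?_⟩
  · refine (hasBasis_iInf_principal_finite s).neBot_iff.2 fun {t} ht ↦ ?_
    obtain ⟨p, hp⟩ := exists_mem_traceSet_iff ht.toFinset 𝒟
    exact ⟨p, mem_iInter₂.2 fun A hA ↦ hp A (ht.mem_toFinset.2 hA)⟩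
  · exact mem_of_superset (hs A) fun p hp ↦ hp.2 hA
  · exact mem_of_superset (hs A) fun p hp h ↦ hA (hp.1 h)

theorem mk_Iio_ord_lt {c : Cardinal} (i : c.ord.ToType) : #(Iio i) < c := by
  simpa using mk_Iio_lt i (by simp)

/-- On a well order of the type of an infinite cardinal `#X`, there are as many pairwise separated
filters of tails as there are families of subsets of `X`. -/
theorem exists_separated_filters (X : Type*) [Infinite X] :
    ∃ φ : Set (Set X) → Filter (#X).ord.ToType, (∀ 𝒟, (φ 𝒟).NeBot ∧ ∀ i, Ici i ∈ φ 𝒟) ∧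
      ∀ 𝒟 ℰ, 𝒟 ≠ ℰ → ∃ T, T ∈ φ 𝒟 ∧ Tᶜ ∈ φ ℰ := by
  choose ψ hψ hmem hcompl using exists_filter_traceSet (X := X)
  have hcard : #((Finset X × Finset (Finset X)) × (#X).ord.ToType) = #(#X).ord.ToType := by
    simp [mul_eq_self (aleph0_le_mk X)]
  obtain ⟨f⟩ := Cardinal.eq.1 hcard
  let π : (#X).ord.ToType → Finset X × Finset (Finset X) := fun i ↦ (f.symm i).1
  -- Each fibre of `π` has cardinality `#X`, too many to fit in a proper initial segment, so it is
  -- cofinal.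
  have htail (i : (#X).ord.ToType) (p) : (Ici i ∩ π ⁻¹' {p}).Nonempty := by
    by_contra h
    have hsub : range (fun j ↦ f (p, j)) ⊆ Iio i := by
      rintro _ ⟨j, rfl⟩
      by_contra hj
      exact h ⟨f (p, j), mem_Ici.2 (not_lt.1 hj), by simp [π]⟩
    have hinj : Function.Injective fun j ↦ f (p, j) := fun j k hjk ↦ by simpa using hjk
    have h1 := mk_le_mk_of_subset hsub
    rw [mk_range_eq _ hinj, mk_ord_toType] at h1
    exact h1.not_gt (mk_Iio_ord_lt i)
  have : Nonempty (#X).ord.ToType := by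
    rw [← mk_ne_zero_iff, mk_ord_toType]
    exact mk_ne_zero X
  refine ⟨fun 𝒟 ↦ atTop ⊓ comap π (ψ 𝒟), fun 𝒟 ↦ ⟨?_, fun i ↦ ?_⟩, fun 𝒟 ℰ hne ↦ ?_⟩
  · refine inf_neBot_iff.2 fun {s} hs {t} ht ↦ ?_
    obtain ⟨i, hi⟩ := mem_atTop_sets.1 hs
    obtain ⟨u, hu, hut⟩ := ht
    obtain ⟨p, hp⟩ := (hψ 𝒟).nonempty_of_mem hu
    obtain ⟨j, hj, hjp⟩ := htail i p
    exact ⟨j, hi j hj, hut (by rwa [mem_preimage, show π j = p from hjp])⟩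
  · exact mem_inf_of_left (Ici_mem_atTop i)
  · obtain ⟨A, hA⟩ : ∃ A, ¬ (A ∈ 𝒟 ↔ A ∈ ℰ) := by
      by_contra! h
      exact hne (Set.ext h)
    by_cases hD : A ∈ 𝒟
    · have hE : A ∉ ℰ := fun h ↦ hA (by simp [hD, h])
      exact ⟨π ⁻¹' traceSet A, mem_inf_of_right (preimage_mem_comap (hmem _ A hD)),
        mem_inf_of_right (preimage_mem_comap (hcompl _ A hE))⟩
    · have hE : A ∈ ℰ := by
        by_contra h
        exact hA (by simp [hD, h])
      refine ⟨π ⁻¹' (traceSet A)ᶜ, mem_inf_of_right (preimage_mem_comap (hcompl _ A hD)),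
        mem_inf_of_right ?_⟩
      rw [preimage_compl, compl_compl]
      exact preimage_mem_comap (hmem _ A hE)

/-! ### A sparse sequence in a group -/

theorem mk_Iic_ord_lt {c : Cardinal} (hc : ℵ₀ ≤ c) (i : c.ord.ToType) : #(Iic i) < c := by
  rw [← Iio_insert]
  exact (mk_insert_le).trans_lt
    (add_lt_of_lt hc (mk_Iio_ord_lt i) (one_lt_aleph0.trans_le hc))

/-- Transfinite recursion: at stage `j` fewer than `#G` values are forbidden, namely the range of
`f`. -/
theorem exists_sparse_sequence (G : Type*) [Group G] [Infinite G] (e : (#G).ord.ToType → G) :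
    ∃ x : (#G).ord.ToType → G, ∀ i j, i < j → ∀ b ≤ i, ∀ c ≤ j, e b * x i ≠ e c * x j := by
  have hG := aleph0_le_mk G
  have step (j : (#G).ord.ToType) (y : Iio j → G) :
      ∃ z, ∀ i : Iio j, ∀ b c : Iic j, e b * y i ≠ e c * z := by
    let f : Iio j × Iic j × Iic j → G := fun p ↦ (e p.2.2)⁻¹ * (e p.2.1 * y p.1)
    have hf : #(range f) < #G := by
      refine mk_range_le.trans_lt ?_
      simp only [mk_prod, lift_id]
      have h := mk_Iic_ord_lt hG j
      exact mul_lt_of_lt hG (mk_Iio_ord_lt j) (mul_lt_of_lt hG h h)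
    obtain ⟨z, hz⟩ : ∃ z, z ∉ range f := by
      by_contra! h
      rw [eq_univ_of_forall h, mk_univ] at hf
      exact hf.false
    refine ⟨z, fun i b c h ↦ hz ⟨(i, b, c), ?_⟩⟩
    simp [f, h]
  choose z hz using step
  let x : (#G).ord.ToType → G := WellFoundedLT.fix fun j y ↦ z j fun i ↦ y i.1 i.2
  have hx (j) : x j = z j fun i ↦ x i.1 := WellFoundedLT.fix_eq _ j
  refine ⟨x, fun i j hij b hb c hc ↦ ?_⟩
  rw [hx j]
  exact hz j (fun i ↦ x i.1) ⟨i, hij⟩ ⟨b, hb.trans hij.le⟩ ⟨c, hc⟩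

/-- The sets which eventually contain every left translate of the sequence `x` along `φ`. -/
def translateFilter {G ι : Type*} [Group G] (x : ι → G) (φ : Filter ι) : Filter G :=
  ⨆ g : G, φ.map (g * x ·)

theorem mem_translateFilter {G ι : Type*} [Group G] {x : ι → G} {φ : Filter ι} {A : Set G} :
    A ∈ translateFilter x φ ↔ ∀ g : G, ∀ᶠ i in φ, g * x i ∈ A := by
  simp [translateFilter, Filter.Eventually, preimage]

theorem tendsto_mul_left_translateFilter {G ι : Type*} [Group G] (x : ι → G) (φ : Filter ι)
    (g : G) : Tendsto (g * ·) (translateFilter x φ) (translateFilter x φ) := by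
  intro A hA
  refine mem_translateFilter.2 fun h ↦ ?_
  simpa [mul_assoc] using mem_translateFilter.1 hA (g * h)

theorem translateFilter_neBot {G ι : Type*} [Group G] (x : ι → G) (φ : Filter ι) [φ.NeBot] :
    (translateFilter x φ).NeBot :=
  (inferInstance : (φ.map ((1 : G) * x ·)).NeBot).mono (le_iSup (fun g : G ↦ φ.map (g * x ·)) 1)

section Separation

variable {G I : Type*} [Group G] [LinearOrder I] {e : I ≃ G} {x : I → G}

/-- For a fixed `g`, the bound `b ≤ i` only excludes indices below `e.symm g`, and `φ` ignores
those. -/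
theorem mem_translateFilter_of_tails {φ : Filter I} (hφ : ∀ i, Ici i ∈ φ) {T : Set I} (hT : T ∈ φ) :
    {g | ∃ i ∈ T, ∃ b ≤ i, g = e b * x i} ∈ translateFilter x φ := by
  refine mem_translateFilter.2 fun g ↦ ?_
  filter_upwards [hT, hφ (e.symm g)] with i hi hgi
  exact ⟨i, hi, e.symm g, hgi, by simp⟩

theorem disjoint_translates (hx : ∀ i j, i < j → ∀ b ≤ i, ∀ c ≤ j, e b * x i ≠ e c * x j)
    (T : Set I) :
    Disjoint {g | ∃ i ∈ T, ∃ b ≤ i, g = e b * x i} {g | ∃ i ∈ Tᶜ, ∃ b ≤ i, g = e b * x i} := by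
  rw [Set.disjoint_left]
  rintro _ ⟨i, hi, b, hb, rfl⟩ ⟨j, hj, c, hc, h⟩
  rcases lt_trichotomy i j with hij | rfl | hij
  · exact hx i j hij b hb c hc h
  · exact hj hi
  · exact hx j i hij c hc b hb h.symm

theorem translateFilter_le_cofinite
    (hx : ∀ i j, i < j → ∀ b ≤ i, ∀ c ≤ j, e b * x i ≠ e c * x j) [NoMaxOrder I]
    {φ : Filter I} (hφ : ∀ i, Ici i ∈ φ) : translateFilter x φ ≤ cofinite := by
  refine le_cofinite_iff_compl_singleton_mem.2 fun c ↦ mem_translateFilter.2 fun g ↦ ?_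
  -- By sparseness at most one such `i` exists; the tail beyond it avoids `c`.
  by_cases h : ∃ i, e.symm g ≤ i ∧ g * x i = c
  · obtain ⟨i, hgi, rfl⟩ := h
    obtain ⟨k, hk⟩ := exists_gt i
    filter_upwards [hφ k] with j hkj hj
    have hij := hk.trans_le hkj
    refine hx i j hij (e.symm g) hgi (e.symm g) (hgi.trans hij.le) ?_
    simpa using hj.symm
  · filter_upwards [hφ (e.symm g)] with j hj hjc
    exact h ⟨j, hj, hjc⟩

end Separation

theorem le_mk_isMaximalLeftInvariantBornology (G : Type*) [Group G] [Infinite G] :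
    2 ^ (2 ^ #G : Cardinal) ≤ #{B : Bornology G // IsMaximalLeftInvariantBornology B} := by
  obtain ⟨e⟩ := Cardinal.eq.1 (mk_ord_toType #G)
  obtain ⟨x, hx⟩ := exists_sparse_sequence G e
  obtain ⟨φ, hφ, hsep⟩ := exists_separated_filters G
  have : NoMaxOrder (#G).ord.ToType := noMaxOrder (aleph0_le_mk G)
  have hex (𝒟 : Set (Set G)) := by
    have := (hφ 𝒟).1
    have := translateFilter_neBot x (φ 𝒟)
    exact exists_isMaximalLeftInvariantBornology_le (translateFilter x (φ 𝒟))
      (translateFilter_le_cofinite hx (hφ 𝒟).2) (tendsto_mul_left_translateFilter x (φ 𝒟))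
  choose B hB hBφ using hex
  rw [← mk_set, ← mk_set]
  refine mk_le_of_injective (f := fun 𝒟 ↦ ⟨B 𝒟, hB 𝒟⟩) fun 𝒟 ℰ h ↦ ?_
  by_contra hne
  obtain ⟨T, hT, hT'⟩ := hsep 𝒟 ℰ hne
  have hBE : B 𝒟 = B ℰ := congrArg Subtype.val h
  have h1 := hBφ 𝒟 (mem_translateFilter_of_tails (e := e) (hφ 𝒟).2 hT)
  have h2 := hBφ ℰ (mem_translateFilter_of_tails (e := e) (hφ ℰ).2 hT')
  rw [← hBE] at h2
  have h3 := inter_mem h1 h2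
  rw [(disjoint_translates hx T).inter_eq, empty_mem_iff_bot] at h3
  exact (hB 𝒟).2.1 (univ_mem_boundedSets_iff.2 h3)

theorem theorem1p3 {G : Type*} [Group G] [Infinite G] (κ : Cardinal) (hκ : Cardinal.mk G = κ) :
    Cardinal.mk {B : Bornology G // IsMaximalLeftInvariantBornology B} =
      (2 : Cardinal) ^ ((2 : Cardinal) ^ κ) := by
  subst hκ
  exact le_antisymm ((mk_subtype_le _).trans (mk_bornology_le G))
    (le_mk_isMaximalLeftInvariantBornology G)
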